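/- **Setting.** A *program in the nested dataflow (ND) model* is a finite spawn tree together with sets of fire rules. The leaves of the tree are strands (nonempty sequences of instructions, each accessing at most one memory location). Its internal nodes are serial or parallel compositions of at least two subtasks, or binary "fire" compositions; unfolding an internal node is one instruction, which may access at most one memory location. The DAG rewriting system turns serial nodes, fire nodes and fire rules into dependencies between strands. A *task* is (the subtree at) a node; its *size* $S(\cdot)$ is the number of distinct memory locations accessed in it. A task is *done* when all its strands have been executed, and *ready* when every strand outside it on which one of its strands depends is done. A task is *$M$-maximal* if its size is at most $M$ and its parent, if it has one, has size $>M$. If all strands of a task $Q$ have size at most $M$, then $Q$ decomposes uniquely into $M$-maximal subtasks and the internal nodes above them (*glue nodes*; if $S(Q)\le M$, then $Q$ itself is the only piece), and the *parallel cache complexity* $Q^*(Q;M)$ is the sum of the sizes of these maximal subtasks plus one for each glue node. A *parallel memory hierarchy* (PMH) is a symmetric tree with an infinite main memory as root at level $h$, caches at levels $1,\dots,h-1$ and processors as leaves; every level-$k$ node has $f_k\ge 1$ children, every level-$j$ cache holds $M_j\ge 1$ words, $M_1\le M_2\le\dots\le M_{h-1}$, and cache blocks are one word long. In an execution (a sequence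 of instructions executed by processors that respects the unfolding of the tree and the dependencies), an access by a processor is serviced by the lowest cache above it that holds the location, or by main memory; it is a miss at each lower cache above the processor, and loads the location into each of these caches. All caches are empty initially, nothing else is ever loaded, capacities are never exceeded, and replacement is ideal, i.e. evictions are chosen optimally. A *space-bounded scheduler* with dilation parameter $\sigma\in(0,1)$ is one with the following properties. *Anchoring:* ready tasks are anchored to caches with respect to which they are maximal, where a task anchored at a level-$j$ cache must be $\sigma M_j$-maximal; a task that is $\sigma M_j$-maximal for some cache level $j$ is, before any of it is executed, anchored at least at the lowest such level; an anchored task is executed only after it has been anchored, and only by processors allocated to it below that cache. *Boundedness:* at any time, the tasks that are anchored to a given level-$j$ cache and not yet done have total size at most $\sigma M_j$. The whole program is also regarded as anchored at the main memory (level $h$). **Theorem.** Let $0<\sigma<1$ and consider any (possibly unfinished) execution of an ND program on a PMH under a space-bounded scheduler with dilation parameter $\sigma$. The caches can be managed during this execution so that, simultaneously for all tasks $Q$ and all levels $i$ such that $Q$ is anchored at level $i$, and all cache levels $j\le i$ such that every strand of $Q$ has size at most $\sigma M_j$, the total number of cache misses, summed over all level-$j$ caches, that are incurred by the instructions of $Q$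 is at most $Q^*(Q;\sigma M_j)$. -/

import Mathlib

namespace ND

/-! ### Nested dataflow programs -/

/-- Composition constructs labelling the internal nodes of a spawn tree: serial and parallel
composition of `k + 2` subtasks, and the binary fire construct of type `t`. -/
inductive Construct (Typ : Type*) where
  | serial (k : ℕ)
  | parallel (k : ℕ)
  | fire (t : Typ)

/-- The number of subtasks that a construct composes. -/
def Construct.arity {Typ : Type*} : Construct Typ → ℕ
  | .serial k => k + 2
  | .parallel k => k + 2
  | .fire _ => 2

/-- Spawn trees. A leaf is a strand, a nonempty sequence of instructions, each of which accesses
at most one memory location. An internal node composes its subtasks; unfolding it is one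
instruction, which may access one memory location `ctl` (`none` if it accesses no memory). -/
inductive SpawnTree (Loc Typ : Type*) where
  | strand (first : Option Loc) (rest : List (Option Loc))
  | node (op : Construct Typ) (ctl : Option Loc) (child : Fin op.arity → SpawnTree Loc Typ)

namespace SpawnTree

variable {Loc Typ : Type*}

/-- The instructions that belong to the root node of the tree itself. -/
def instrs : SpawnTree Loc Typ → List (Option Loc)
  | strand first rest => first :: rest
  | node _ ctl _ => [ctl]

/-- The subtree at a pedigree (the list of child indices, counted from `0`, on the path from the
root), if there is one. -/
def sub : SpawnTree Loc Typ → List ℕ → Option (SpawnTree Loc Typ)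
  | t, [] => some t
  | strand _ _, _ :: _ => none
  | node op _ child, i :: p => if h : i < op.arity then (child ⟨i, h⟩).sub p else none

/-- The finite set of the pedigrees of all nodes. -/
def nodes : SpawnTree Loc Typ → Finset (List ℕ)
  | strand _ _ => {[]}
  | node _ _ child =>
      insert [] (Finset.univ.biUnion fun i => (child i).nodes.image fun p => (i : ℕ) :: p)

/-- The set of memory locations accessed by a task. -/
def footprint [DecidableEq Loc] : SpawnTree Loc Typ → Finset Loc
  | strand first rest => (first :: rest).reduceOption.toFinset
  | node _ ctl child => ctl.toFinset ∪ Finset.univ.biUnion fun i => (child i).footprint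

/-- The size of a task: the number of distinct memory locations it accesses. -/
def size [DecidableEq Loc] (t : SpawnTree Loc Typ) : ℕ := t.footprint.card

open Classical in
/-- The parallel cache complexity: the sum of the sizes of the `M`-maximal subtasks of the task,
plus one for every glue node (a node of the task that lies in no `M`-maximal subtask). -/
noncomputable def pcc [DecidableEq Loc] (M : ℝ) : SpawnTree Loc Typ → ℕ
  | strand first rest =>
      if ((strand first rest : SpawnTree Loc Typ).size : ℝ) ≤ M
      then (strand first rest : SpawnTree Loc Typ).size else 1
  | node op ctl child =>
      if ((node op ctl child).size : ℝ) ≤ M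
      then (node op ctl child).size else 1 + ∑ i, (child i).pcc M

/-- The node at pedigree `v` is an `M`-maximal task: its size is at most `M`, and the size of its
parent, if it has one, is more than `M`. -/
def IsMaximal [DecidableEq Loc] (T : SpawnTree Loc Typ) (M : ℝ) (v : List ℕ) : Prop :=
  ∃ t, T.sub v = some t ∧ (t.size : ℝ) ≤ M ∧
    ∀ u i, v = u ++ [i] → ∀ s, T.sub u = some s → M < (s.size : ℝ)

/-- Every strand of the task has size at most `M`; equivalently every strand lies in an
`M`-maximal subtask, so that the task decomposes into `M`-maximal subtasks and internal nodes
(glue nodes) above them. -/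
def StrandsFit [DecidableEq Loc] (T : SpawnTree Loc Typ) (M : ℝ) : Prop :=
  ∀ w first rest, T.sub w = some (strand first rest) →
    ((strand first rest : SpawnTree Loc Typ).size : ℝ) ≤ M

/-- The node at pedigree `v` is a strand. -/
def IsStrand (T : SpawnTree Loc Typ) (v : List ℕ) : Prop :=
  ∃ first rest, T.sub v = some (strand first rest)

end SpawnTree

/-- Labels of dataflow arrows: a full (solid) dependency, or a partial (dashed) dependency whose
meaning is given by the fire rules of its type. -/
inductive Label (Typ : Type*) where
  | full
  | fire (t : Typ)

/-- A fire rule: an arrow with the given label from the descendant of the source at pedigree `src`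
to the descendant of the sink at pedigree `snk`. -/
structure FireRule (Typ : Type*) where
  src : List ℕ
  label : Label Typ
  snk : List ℕ

/-- A program in the nested dataflow model: its spawn tree, and a set of fire rules for every type
of fire construct. -/
structure Program (Loc Typ : Type*) where
  tree : SpawnTree Loc Typ
  rules : Typ → List (FireRule Typ)

namespace Program

variable {Loc Typ : Type*}

/-- The DAG rewriting system. `P.Flow a p l q b` says that it generates a dataflow arrow with label
`l` from the node `a` to the node `b`, which is still to be moved down from `a` along the pedigree
`p` and from `b` along the pedigree `q`. -/
inductive Flow (P : Program Loc Typ) :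
    List ℕ → List ℕ → Label Typ → List ℕ → List ℕ → Prop
  /-- a serial construct puts a full arrow from each subtask to every later one -/
  | serial {a : List ℕ} {k ctl child} {i j : ℕ} :
      P.tree.sub a = some (.node (.serial k) ctl child) → i < j → j < k + 2 →
      Flow P (a ++ [i]) [] .full [] (a ++ [j])
  /-- a fire construct puts a dashed arrow from its first to its second subtask -/
  | fire {a : List ℕ} {t ctl child} :
      P.tree.sub a = some (.node (.fire t) ctl child) →
      Flow P (a ++ [0]) [] (.fire t) [] (a ++ [1])
  /-- a dashed arrow whose ends are not both strands is rewritten by the fire rules of its type -/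
  | rewrite {a b : List ℕ} {t r} :
      Flow P a [] (.fire t) [] b → ¬ (P.tree.IsStrand a ∧ P.tree.IsStrand b) → r ∈ P.rules t →
      Flow P a r.src r.label r.snk b
  /-- the source spawns -/
  | src {a p q b : List ℕ} {l i} :
      Flow P a (i :: p) l q b → (P.tree.sub (a ++ [i])).isSome → Flow P (a ++ [i]) p l q b
  /-- the sink spawns -/
  | snk {a p q b : List ℕ} {l i} :
      Flow P a p l (i :: q) b → (P.tree.sub (b ++ [i])).isSome → Flow P a p l q (b ++ [i])
  /-- a strand has no subtasks, so an arrow that starts there stays there -/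
  | srcStrand {a p q b : List ℕ} {l i} :
      Flow P a (i :: p) l q b → P.tree.IsStrand a → Flow P a [] l q b
  /-- a strand has no subtasks, so an arrow that ends there stays there -/
  | snkStrand {a p q b : List ℕ} {l i} :
      Flow P a p l (i :: q) b → P.tree.IsStrand b → Flow P a p l [] b
  /-- a full arrow is inherited by all subtasks of its source -/
  | fullSrc {a b : List ℕ} {i} :
      Flow P a [] .full [] b → (P.tree.sub (a ++ [i])).isSome → Flow P (a ++ [i]) [] .full [] b
  /-- a full arrow is inherited by all subtasks of its sink -/
  | fullSnk {a b : List ℕ} {i} :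
      Flow P a [] .full [] b → (P.tree.sub (b ++ [i])).isSome → Flow P a [] .full [] (b ++ [i])

/-- The edges of the algorithm DAG: strand `y` depends on strand `x`. A dashed arrow between two
strands is a dependency unless its type has no fire rules. -/
def Depends (P : Program Loc Typ) (x y : List ℕ) : Prop :=
  P.tree.IsStrand x ∧ P.tree.IsStrand y ∧
    (P.Flow x [] .full [] y ∨ ∃ t, P.rules t ≠ [] ∧ P.Flow x [] (.fire t) [] y)

end Program

/-! ### Parallel memory hierarchies -/

/-- A parallel memory hierarchy: a symmetric tree whose root, at level `h`, is a main memory of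
infinite size, whose nodes at the levels `1, …, h - 1` are caches, and whose leaves, at level `0`,
are processors. A node at level `k ≥ 1` has `f k` children; a cache at level `j` holds `M j`
words. Cache blocks are one word long. -/
structure PMH where
  h : ℕ
  f : ℕ → ℕ
  M : ℕ → ℕ
  f_pos : ∀ k, 1 ≤ k → k ≤ h → 0 < f k
  M_pos : ∀ j, 1 ≤ j → j < h → 0 < M j
  M_mono : ∀ j k, 1 ≤ j → j ≤ k → k < h → M j ≤ M k

namespace PMH

/-- The number of processors below a node at level `j`. -/
def clusterSize (H : PMH) (j : ℕ) : ℕ := ∏ k ∈ Finset.Icc 1 j, H.f k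

/-- The number of processors; they are numbered from left to right starting with `0`. -/
def numProcs (H : PMH) : ℕ := H.clusterSize H.h

/-- The number of nodes at level `j`; they are numbered from left to right starting with `0`. -/
def numCaches (H : PMH) (j : ℕ) : ℕ := ∏ k ∈ Finset.Icc (j + 1) H.h, H.f k

/-- The (number of the) level-`j` node above processor `p`. -/
def cacheOf (H : PMH) (j p : ℕ) : ℕ := p / H.clusterSize j

/-- `j` is a cache level. -/
def IsCacheLevel (H : PMH) (j : ℕ) : Prop := 1 ≤ j ∧ j < H.h

end PMH

/-! ### Executions -/

/-- An event: processor `proc` executes the next instruction of the node `node`. -/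
structure Event where
  proc : ℕ
  node : List ℕ

section Trace

variable {Loc Typ : Type*}

/-- The number of instructions of node `v` executed in the first `τ` events. -/
def executed (tr : List Event) (τ : ℕ) (v : List ℕ) : ℕ :=
  ((tr.take τ).map Event.node).count v

/-- After the first `τ` events the task `v` is done: its whole subtree has been executed. (Internal
nodes are executed before their descendants, so this means that all its strands have been.) -/
def Done (P : Program Loc Typ) (tr : List Event) (τ : ℕ) (v : List ℕ) : Prop :=
  ∀ w t, v <+: w → P.tree.sub w = some t → t.instrs.length ≤ executed tr τ w

/-- After the first `τ` events the task `v` is ready: all dependencies of its strands on strands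
outside its subtree are satisfied. -/
def Ready (P : Program Loc Typ) (tr : List Event) (τ : ℕ) (v : List ℕ) : Prop :=
  ∀ x y, P.Depends x y → v <+: y → ¬ v <+: x → Done P tr τ x

end Trace

/-- A (possibly unfinished) execution of a program on a hierarchy, as the sequence of its events;
concurrent events are listed in the order in which they reach the caches. -/
structure Execution {Loc Typ : Type*} (H : PMH) (P : Program Loc Typ) where
  events : List Event
  /-- only processors of the machine execute instructions -/
  proc_lt : ∀ e ∈ events, e.proc < H.numProcs
  /-- only instructions of the program are executed, each at most once -/
  valid : ∀ (τ : ℕ) e, events[τ]? = some e →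
    ∃ t, P.tree.sub e.node = some t ∧ executed events τ e.node < t.instrs.length
  /-- a strand is executed by one processor -/
  one_proc : ∀ e ∈ events, ∀ e' ∈ events, e.node = e'.node → e.proc = e'.proc
  /-- a node can be executed only when its parent has been unfolded -/
  unfolded : ∀ (τ : ℕ) e, events[τ]? = some e →
    ∀ u i, e.node = u ++ [i] → 0 < executed events τ u
  /-- a strand can be executed only when all strands on which it depends are done -/
  respects : ∀ (τ : ℕ) e, events[τ]? = some e → ∀ x, P.Depends x e.node → Done P events τ x

namespace Execution

variable {Loc Typ : Type*} {H : PMH} {P : Program Loc Typ}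

/-- Event number `τ` takes place on processor `p`, belongs to node `v`, and accesses the memory
location `x`. -/
def Accesses (E : Execution H P) (τ p : ℕ) (v : List ℕ) (x : Loc) : Prop :=
  E.events[τ]? = some ⟨p, v⟩ ∧
    ∃ t, P.tree.sub v = some t ∧ t.instrs[executed E.events τ v]? = some (some x)

/-- With `content j c` the content of cache number `c` at level `j`, an access to `x` by processor
`p` misses at level `j`: no cache at a level `≤ j` above the processor holds `x`, so the access has
to be serviced from a level `> j`. -/
def Misses (H : PMH) (content : ℕ → ℕ → Finset Loc) (j p : ℕ) (x : Loc) : Prop :=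
  ∀ l, 1 ≤ l → l ≤ j → x ∉ content l (H.cacheOf l p)

/-- A possible behaviour of the caches in an execution: `content τ j c` is the content of cache
number `c` at level `j` after `τ` events. All caches start empty and never exceed their capacity.
An access loads its location into every cache where it misses, and into no other cache; nothing
else is ever loaded. What is evicted, and when, is left to the replacement policy. -/
structure CacheRun (E : Execution H P) where
  content : ℕ → ℕ → ℕ → Finset Loc
  start : ∀ j c, content 0 j c = ∅
  capacity : ∀ τ j c, H.IsCacheLevel j → (content τ j c).card ≤ H.M j
  /-- a missed location is loaded -/
  load : ∀ τ p v x j, H.IsCacheLevel j → E.Accesses τ p v x → Misses H (content τ) j p x →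
    x ∈ content (τ + 1) j (H.cacheOf j p)
  /-- whatever enters a cache has just been missed there -/
  only_load : ∀ τ j c y, H.IsCacheLevel j → y ∈ content (τ + 1) j c → y ∉ content τ j c →
    ∃ p v, E.Accesses τ p v y ∧ H.cacheOf j p = c ∧ Misses H (content τ) j p y

open Classical in
/-- The number of misses at cache number `c` of level `j` incurred by instructions of task `Q`. -/
noncomputable def CacheRun.missCount {E : Execution H P} (R : E.CacheRun) (Q : List ℕ)
    (j c : ℕ) : ℕ :=
  ((Finset.range E.events.length).filter fun τ => ∃ p v x, Q <+: v ∧ E.Accesses τ p v x ∧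
    H.cacheOf j p = c ∧ Misses H (R.content τ) j p x).card

/-- The sum over all level-`j` caches of the misses incurred by instructions of task `Q`. -/
noncomputable def CacheRun.totalMisses {E : Execution H P} (R : E.CacheRun) (Q : List ℕ)
    (j : ℕ) : ℕ :=
  ∑ c ∈ Finset.range (H.numCaches j), R.missCount Q j c

end Execution

/-! ### Space-bounded schedulers -/

/-- The decisions of a scheduler in one run: the resulting execution, for every task `v` and level
`j` the level-`j` cache (if any) to which `v` is anchored, the time (number of events) at which it
is anchored there, and the set of processors it is allocated. -/
structure Schedule {Loc Typ : Type*} (H : PMH) (P : Program Loc Typ) extends Execution H P where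
  anchor : List ℕ → ℕ → Option ℕ
  anchorTime : List ℕ → ℕ → ℕ
  alloc : List ℕ → ℕ → Set ℕ

namespace Schedule

variable {Loc Typ : Type*} {H : PMH} {P : Program Loc Typ}

/-- After `τ` events the task `v` is anchored to cache number `c` of level `j`: it has been anchored
there and is not done yet (the anchor is released when the task is done). -/
def Holds (S : Schedule H P) (τ j c : ℕ) (v : List ℕ) : Prop :=
  S.anchor v j = some c ∧ S.anchorTime v j ≤ τ ∧ ¬ Done P S.events τ v

/-- Task `v` is anchored at level `i`, to a cache or, in the case of the whole program, to the main
memory at the root of the hierarchy. -/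
def AnchoredAt (S : Schedule H P) (v : List ℕ) (i : ℕ) : Prop :=
  (∃ c, S.anchor v i = some c) ∨ (i = H.h ∧ v = [])

open Classical in
/-- The anchoring and boundedness properties that define a space-bounded scheduler with dilation
parameter `σ`. A task fits a level-`j` cache if its size is at most `σ * M j`. -/
structure IsSpaceBounded [DecidableEq Loc] (σ : ℝ) (S : Schedule H P) : Prop where
  /-- a task is anchored only to caches with respect to which it is maximal -/
  anchor_maximal : ∀ v j c, S.anchor v j = some c →
    H.IsCacheLevel j ∧ c < H.numCaches j ∧ P.tree.IsMaximal (σ * H.M j) v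
  /-- a task that is maximal for some cache level must, to be executed, be anchored at the lowest
  cache level where it fits -/
  anchored : ∀ e ∈ S.events, ∀ v, v <+: e.node → ∀ j, H.IsCacheLevel j →
    P.tree.IsMaximal (σ * H.M j) v → (∀ l, 1 ≤ l → l < j → ¬ P.tree.IsMaximal (σ * H.M l) v) →
    (S.anchor v j).isSome
  /-- only ready tasks are anchored -/
  ready : ∀ v j c, S.anchor v j = some c → Ready P S.events (S.anchorTime v j) v
  /-- an anchored task is allocated a part of the subcluster below its cache -/
  alloc_subset : ∀ v j c, S.anchor v j = some c →
    S.alloc v j ⊆ {p | p < H.numProcs ∧ H.cacheOf j p = c}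
  /-- an anchored task is executed after it has been anchored, by its allocated processors -/
  runs_in : ∀ v j c, S.anchor v j = some c → ∀ (τ : ℕ) e, S.events[τ]? = some e → v <+: e.node →
    S.anchorTime v j ≤ τ ∧ e.proc ∈ S.alloc v j
  /-- at any time the tasks anchored to a level-`j` cache have total size at most `σ * M j` -/
  bounded : ∀ τ j c, H.IsCacheLevel j →
    ∑ v ∈ P.tree.nodes.filter (S.Holds τ j c), (((P.tree.sub v).elim 0 SpawnTree.size : ℕ) : ℝ)
      ≤ σ * H.M j

end Schedule

end ND

namespace ND

/-! ### Subtrees and footprints -/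

namespace SpawnTree

variable {Loc Typ : Type*}

/-! One eviction policy serves all tasks and levels at once: at every event each cache drops
whatever no task currently anchored to it accesses. By boundedness the retained locations number at
most `σ * M j < M j`, so a slot is free for the one location an event can load (`cacheRun`).

Let `v` be maximal for level `j`, and `l ≤ j` the lowest level for which it is maximal. All of `v`
runs below a single level-`l` cache, its anchor, which keeps every location of `v` from its first
miss there until `v` is done. A level-`j` miss is by definition also a level-`l` miss, so `v` incurs
at most one level-`j` miss per location (`not_misses_of_lt`, `card_missTimes_le_size`).

A glue node is a single instruction, hence at most one miss. Induction on the spawn tree adds these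
bounds up exactly as `pcc` does (`card_missTimes_le_pcc`). -/

theorem sub_nil (t : SpawnTree Loc Typ) : t.sub [] = some t := by
  cases t <;> rfl

theorem sub_append (t : SpawnTree Loc Typ) (p q : List ℕ) :
    t.sub (p ++ q) = (t.sub p).bind fun s => s.sub q := by
  induction p generalizing t with
  | nil => simp [sub_nil]
  | cons i p ih =>
    cases t with
    | strand first rest => rfl
    | node op ctl child =>
      simp only [List.cons_append, sub]
      split_ifs with h
      · exact ih _
      · rfl

theorem sub_append_of_eq_some {t s : SpawnTree Loc Typ} {p : List ℕ} (h : t.sub p = some s)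
    (q : List ℕ) : t.sub (p ++ q) = s.sub q := by
  rw [sub_append, h, Option.bind_some]

theorem mem_nodes_of_sub {t s : SpawnTree Loc Typ} {p : List ℕ} (h : t.sub p = some s) :
    p ∈ t.nodes := by
  induction p generalizing t with
  | nil => cases t <;> simp [nodes]
  | cons i p ih =>
    cases t with
    | strand first rest => simp [sub] at h
    | node op ctl child =>
      simp only [sub] at h
      split_ifs at h with hi
      simp only [nodes, Finset.mem_insert, Finset.mem_biUnion, Finset.mem_image]
      exact Or.inr ⟨⟨i, hi⟩, Finset.mem_univ _, p, ih h, rfl⟩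

variable [DecidableEq Loc]

theorem footprint_subset_of_sub {t s : SpawnTree Loc Typ} {p : List ℕ} (h : t.sub p = some s) :
    s.footprint ⊆ t.footprint := by
  induction p generalizing t with
  | nil =>
    rw [sub_nil] at h
    cases h
    exact subset_rfl
  | cons i p ih =>
    cases t with
    | strand first rest => simp [sub] at h
    | node op ctl child =>
      simp only [sub] at h
      split_ifs at h with hi
      intro x hx
      simp only [footprint, Finset.mem_union, Finset.mem_biUnion]
      exact Or.inr ⟨⟨i, hi⟩, Finset.mem_univ _, ih h hx⟩

theorem mem_footprint_of_mem_instrs {t : SpawnTree Loc Typ} {x : Loc} (h : some x ∈ t.instrs) :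
    x ∈ t.footprint := by
  cases t with
  | strand first rest =>
    rw [footprint, List.mem_toFinset, List.reduceOption_mem_iff]
    exact h
  | node op ctl child =>
    simp only [instrs, List.mem_singleton] at h
    simp [footprint, ← h]

end SpawnTree

/-! ### Executions and their accesses -/

theorem executed_mono (tr : List Event) {τ τ' : ℕ} (h : τ ≤ τ') (v : List ℕ) :
    executed tr τ v ≤ executed tr τ' v :=
  ((List.take_sublist_take_left h).map _).count_le _

theorem executed_pos_of_lt {tr : List Event} {τ τ' : ℕ} {e : Event} (he : tr[τ]? = some e)
    (h : τ < τ') : 0 < executed tr τ' e.node := by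
  refine List.count_pos_iff.2 (List.mem_map_of_mem (List.mem_iff_getElem?.2 ⟨τ, ?_⟩))
  rw [List.getElem?_take_of_lt h, he]

namespace Execution

variable {Loc Typ : Type*} {H : PMH} {P : Program Loc Typ}

theorem not_done_of_event (E : Execution H P) {τ τ' : ℕ} {e : Event} {v : List ℕ}
    (he : E.events[τ']? = some e) (hv : v <+: e.node) (h : τ ≤ τ') :
    ¬ Done P E.events τ v := by
  intro hd
  obtain ⟨t, ht, hlt⟩ := E.valid τ' e he
  exact absurd ((hd _ t hv ht).trans (executed_mono _ h _)) (not_le.2 hlt)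

/-- An internal node has exactly one instruction; this is why a glue node costs at most one miss. -/
theorem event_unique_of_node (E : Execution H P) {τ τ' p p' : ℕ} {v : List ℕ} {op ctl child}
    (hv : P.tree.sub v = some (.node op ctl child)) (h : E.events[τ]? = some ⟨p, v⟩)
    (h' : E.events[τ']? = some ⟨p', v⟩) : τ = τ' := by
  have key : ∀ {τ τ' p p' : ℕ}, E.events[τ]? = some ⟨p, v⟩ → E.events[τ']? = some ⟨p', v⟩ →
      ¬ τ < τ' := by
    intro τ τ' p p' h h' hlt
    obtain ⟨t, ht, hex⟩ := E.valid τ' _ h'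
    have hpos := executed_pos_of_lt h hlt
    rw [hv] at ht
    cases ht
    exact absurd hex (not_lt.2 hpos)
  exact le_antisymm (not_lt.1 (key h' h)) (not_lt.1 (key h h'))

theorem Accesses.unique {E : Execution H P} {τ p p' : ℕ} {v v' : List ℕ} {x x' : Loc}
    (h : E.Accesses τ p v x) (h' : E.Accesses τ p' v' x') : p = p' ∧ v = v' ∧ x = x' := by
  obtain ⟨he, t, ht, hx⟩ := h
  obtain ⟨he', t', ht', hx'⟩ := h'
  rw [he] at he'
  cases he'
  rw [ht] at ht'
  cases ht'
  rw [hx] at hx'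
  cases hx'
  exact ⟨rfl, rfl, rfl⟩

theorem Accesses.mem_footprint [DecidableEq Loc] {E : Execution H P} {τ p : ℕ} {v w : List ℕ}
    {x : Loc} {t : SpawnTree Loc Typ} (h : E.Accesses τ p w x) (hv : v <+: w)
    (ht : P.tree.sub v = some t) : x ∈ t.footprint := by
  obtain ⟨-, s, hs, hx⟩ := h
  obtain ⟨q, rfl⟩ := hv
  rw [SpawnTree.sub_append_of_eq_some ht] at hs
  exact SpawnTree.footprint_subset_of_sub hs
    (SpawnTree.mem_footprint_of_mem_instrs (List.mem_of_getElem? hx))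

theorem Misses.mono {content : ℕ → ℕ → Finset Loc} {l j p : ℕ} {x : Loc} (h : l ≤ j)
    (hm : Misses H content j p x) : Misses H content l p x :=
  fun k hk hkl => hm k hk (hkl.trans h)

open Classical in
/-- The times of the level-`j` misses incurred by instructions of task `Q`, at any cache. -/
noncomputable def CacheRun.missTimes {E : Execution H P} (R : E.CacheRun) (Q : List ℕ) (j : ℕ) :
    Finset ℕ :=
  (Finset.range E.events.length).filter fun τ => ∃ p v x, Q <+: v ∧ E.Accesses τ p v x ∧
    Misses H (R.content τ) j p x

theorem CacheRun.mem_missTimes {E : Execution H P} {R : E.CacheRun} {Q : List ℕ} {j τ : ℕ} :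
    τ ∈ R.missTimes Q j ↔ ∃ p v x, Q <+: v ∧ E.Accesses τ p v x ∧
      Misses H (R.content τ) j p x := by
  classical
  simp only [missTimes, Finset.mem_filter, Finset.mem_range, and_iff_right_iff_imp]
  rintro ⟨p, v, x, -, ⟨he, -⟩, -⟩
  exact (List.getElem?_eq_some_iff.1 he).1

/-- An event has one processor, hence lies below one level-`j` cache, so the miss times counted at
different caches are disjoint. -/
theorem CacheRun.totalMisses_le_card {E : Execution H P} (R : E.CacheRun) (Q : List ℕ) (j : ℕ) :
    R.totalMisses Q j ≤ (R.missTimes Q j).card := by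
  classical
  unfold totalMisses missCount
  rw [← Finset.card_biUnion]
  · refine Finset.card_le_card fun τ hτ => ?_
    simp only [Finset.mem_biUnion, Finset.mem_filter] at hτ
    obtain ⟨c, -, -, p, v, x, hQ, hA, -, hm⟩ := hτ
    exact mem_missTimes.2 ⟨p, v, x, hQ, hA, hm⟩
  · intro c _ c' _ hne
    refine Finset.disjoint_left.2 fun τ hτ hτ' => hne ?_
    obtain ⟨-, p, v, x, -, hA, rfl, -⟩ := Finset.mem_filter.1 hτ
    obtain ⟨-, p', v', x', -, hA', rfl, -⟩ := Finset.mem_filter.1 hτ'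
    rw [(hA.unique hA').1]

/-- Mirrors the recursive clause of `pcc`: `s` holds the possible miss of the unfolding instruction
of `Q` itself. -/
theorem CacheRun.missTimes_subset_of_node {E : Execution H P} (R : E.CacheRun) {Q : List ℕ} (j : ℕ)
    {op : Construct Typ} {ctl : Option Loc} {child : Fin op.arity → SpawnTree Loc Typ}
    (hQ : P.tree.sub Q = some (.node op ctl child)) :
    ∃ s : Finset ℕ, s.card ≤ 1 ∧ R.missTimes Q j ⊆
      s ∪ Finset.univ.biUnion fun i : Fin op.arity => R.missTimes (Q ++ [(i : ℕ)]) j := by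
  classical
  refine ⟨(R.missTimes Q j).filter fun τ => ∃ p, E.events[τ]? = some ⟨p, Q⟩, ?_, ?_⟩
  · refine Finset.card_le_one.2 fun τ hτ τ' hτ' => ?_
    obtain ⟨p, hp⟩ := (Finset.mem_filter.1 hτ).2
    obtain ⟨p', hp'⟩ := (Finset.mem_filter.1 hτ').2
    exact E.event_unique_of_node hQ hp hp'
  · intro τ hτ
    obtain ⟨p, v, x, ⟨q, rfl⟩, hA, hm⟩ := CacheRun.mem_missTimes.1 hτ
    cases q with
    | nil =>
      refine Finset.mem_union_left _ (Finset.mem_filter.2 ⟨hτ, p, ?_⟩)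
      simpa using hA.1
    | cons i q =>
      obtain ⟨-, s, hs, -⟩ := id hA
      rw [SpawnTree.sub_append_of_eq_some hQ, SpawnTree.sub] at hs
      split_ifs at hs with hi
      refine Finset.mem_union_right _ (Finset.mem_biUnion.2 ⟨⟨i, hi⟩, Finset.mem_univ _, ?_⟩)
      exact CacheRun.mem_missTimes.2 ⟨p, _, x, ⟨q, by simp⟩, hA, hm⟩

end Execution

/-! ### The replacement policy -/

namespace Schedule

variable {Loc Typ : Type*} [DecidableEq Loc] {H : PMH} {P : Program Loc Typ}

open Classical in
/-- The locations accessed by the tasks that are anchored to cache number `c` of level `j` after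
`τ` events. -/
noncomputable def reserved (S : Schedule H P) (τ j c : ℕ) : Finset Loc :=
  (P.tree.nodes.filter (S.Holds τ j c)).biUnion fun v =>
    (P.tree.sub v).elim ∅ SpawnTree.footprint

theorem footprint_subset_reserved {S : Schedule H P} {τ j c : ℕ} {v : List ℕ}
    {t : SpawnTree Loc Typ} (ht : P.tree.sub v = some t) (hv : S.Holds τ j c v) :
    t.footprint ⊆ S.reserved τ j c := by
  classical
  intro x hx
  refine Finset.mem_biUnion.2 ⟨v, Finset.mem_filter.2 ⟨SpawnTree.mem_nodes_of_sub ht, hv⟩, ?_⟩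
  rwa [ht]

/-- Footprints of anchored tasks may overlap, but their union is no larger than the sum that
boundedness controls. Strictness, from `σ < 1` and `0 < M j`, leaves the slot for an incoming
location. -/
theorem card_reserved_lt {S : Schedule H P} {σ : ℝ} (hσ : σ < 1) (hS : S.IsSpaceBounded σ)
    (τ : ℕ) {j : ℕ} (c : ℕ) (hj : H.IsCacheLevel j) : (S.reserved τ j c).card < H.M j := by
  classical
  have hle : ((S.reserved τ j c).card : ℝ) ≤ σ * H.M j := by
    refine le_trans ?_ (hS.bounded τ j c hj)
    rw [← Nat.cast_sum]
    refine Nat.cast_le.2 (Finset.card_biUnion_le.trans (Finset.sum_le_sum fun v _ => ?_))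
    cases P.tree.sub v <;> simp [SpawnTree.size]
  have hM : (0 : ℝ) < H.M j := Nat.cast_pos.2 (H.M_pos j hj.1 hj.2)
  exact_mod_cast hle.trans_lt (by nlinarith : σ * H.M j < H.M j)

open Classical in
/-- The locations that event number `τ` loads into cache number `c` of level `j` when the caches
have the given content. -/
noncomputable def loaded (S : Schedule H P) (τ : ℕ) (content : ℕ → ℕ → Finset Loc) (j c : ℕ) :
    Finset Loc :=
  P.tree.footprint.filter fun x => ∃ p v, S.Accesses τ p v x ∧ H.cacheOf j p = c ∧
    Execution.Misses H content j p x

theorem mem_loaded {S : Schedule H P} {τ : ℕ} {content : ℕ → ℕ → Finset Loc} {j c : ℕ} {x : Loc} :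
    x ∈ S.loaded τ content j c ↔ ∃ p v, S.Accesses τ p v x ∧ H.cacheOf j p = c ∧
      Execution.Misses H content j p x := by
  classical
  simp only [loaded, Finset.mem_filter, and_iff_right_iff_imp]
  rintro ⟨p, v, hA, -⟩
  exact hA.mem_footprint List.nil_prefix (SpawnTree.sub_nil _)

theorem card_loaded_le_one (S : Schedule H P) (τ : ℕ) (content : ℕ → ℕ → Finset Loc) (j c : ℕ) :
    (S.loaded τ content j c).card ≤ 1 := by
  refine Finset.card_le_one.2 fun x hx y hy => ?_
  obtain ⟨p, v, hA, -⟩ := mem_loaded.1 hx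
  obtain ⟨p', v', hA', -⟩ := mem_loaded.1 hy
  exact (hA.unique hA').2.2

/-- The cache contents under the replacement policy that, at every event, evicts whatever is not
accessed by a task anchored to the cache. -/
noncomputable def content (S : Schedule H P) : ℕ → ℕ → ℕ → Finset Loc
  | 0, _, _ => ∅
  | τ + 1, j, c =>
      (S.content τ j c ∩ S.reserved τ j c) ∪ S.loaded τ (S.content τ) j c

/-- The cache behaviour in which only locations of anchored tasks are retained. -/
noncomputable def cacheRun {σ : ℝ} (hσ : σ < 1) (S : Schedule H P) (hS : S.IsSpaceBounded σ) :
    S.toExecution.CacheRun where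
  content := S.content
  start _ _ := rfl
  capacity τ j c hj := by
    cases τ with
    | zero => simp [content]
    | succ τ =>
      have h₁ := card_reserved_lt hσ hS τ c hj
      have h₂ := S.card_loaded_le_one τ (S.content τ) j c
      have h₃ := Finset.card_le_card
        (Finset.inter_subset_right (s₁ := S.content τ j c) (s₂ := S.reserved τ j c))
      exact (Finset.card_union_le _ _).trans (by omega)
  load τ p v x j _ hA hm := Finset.mem_union_right _ (mem_loaded.2 ⟨p, v, hA, rfl, hm⟩)
  only_load τ j c y _ hy hn := by
    rcases Finset.mem_union.1 hy with h | h
    · exact absurd (Finset.mem_inter.1 h).1 hn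
    · exact mem_loaded.1 h

theorem mem_content_of_le {S : Schedule H P} {τ τ' j c : ℕ} {x : Loc} (h : τ ≤ τ')
    (hx : x ∈ S.content τ j c) (hr : ∀ k, τ ≤ k → k < τ' → x ∈ S.reserved k j c) :
    x ∈ S.content τ' j c := by
  induction τ', h using Nat.le_induction with
  | base => exact hx
  | succ n hn ih =>
    exact Finset.mem_union_left _ (Finset.mem_inter.2
      ⟨ih fun k hk hkn => hr k hk (hkn.trans n.lt_succ_self), hr n hn n.lt_succ_self⟩)

/-! ### Counting misses -/

variable {σ : ℝ} {S : Schedule H P}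

/-- While a task is anchored to a level-`l` cache, it misses every location at most once there. -/
theorem not_misses_of_lt (hS : S.IsSpaceBounded σ) {v w w' : List ℕ} {l c τ τ' p p' : ℕ} {x : Loc}
    {t : SpawnTree Loc Typ} (ht : P.tree.sub v = some t) (ha : S.anchor v l = some c)
    (hv : v <+: w) (hA : S.Accesses τ p w x) (hm : Execution.Misses H (S.content τ) l p x)
    (hv' : v <+: w') (hA' : S.Accesses τ' p' w' x) (hlt : τ < τ') :
    ¬ Execution.Misses H (S.content τ') l p' x := by
  intro hm'
  obtain ⟨hl, -⟩ := hS.anchor_maximal v l c ha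
  have hrun := hS.runs_in v l c ha τ _ hA.1 hv
  have hc := (hS.alloc_subset v l c ha hrun.2).2
  have hc' := (hS.alloc_subset v l c ha (hS.runs_in v l c ha τ' _ hA'.1 hv').2).2
  refine hm' l hl.1 le_rfl ?_
  rw [hc']
  refine mem_content_of_le hlt (Finset.mem_union_right _ (mem_loaded.2 ⟨p, w, hA, hc, hm⟩)) ?_
  intro k hk hkτ
  -- Between the two accesses `v` still holds its anchor: it was anchored by time `τ`, and it is not
  -- done since its event `τ'` is yet to come.
  exact footprint_subset_reserved ht
    ⟨ha, hrun.1.trans ((Nat.le_succ τ).trans hk), S.not_done_of_event hA'.1 hv' hkτ.le⟩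
    (hA.mem_footprint hv ht)

theorem card_missTimes_le_size (hσ : σ < 1) (hS : S.IsSpaceBounded σ) {v : List ℕ} {j : ℕ}
    {t : SpawnTree Loc Typ} (ht : P.tree.sub v = some t) (hj : H.IsCacheLevel j)
    (hmax : P.tree.IsMaximal (σ * H.M j) v) :
    ((S.cacheRun hσ hS).missTimes v j).card ≤ t.size := by
  classical
  -- An anchor is guaranteed only at the lowest level where `v` is maximal, which may lie below `j`.
  have hex : ∃ l, 1 ≤ l ∧ P.tree.IsMaximal (σ * H.M l) v := ⟨j, hj.1, hmax⟩
  obtain ⟨hl₁, hlmax⟩ := Nat.find_spec hex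
  have hlj : Nat.find hex ≤ j := Nat.find_min' hex ⟨hj.1, hmax⟩
  have hmin : ∀ k, 1 ≤ k → k < Nat.find hex → ¬ P.tree.IsMaximal (σ * H.M k) v :=
    fun k hk hlt hkm => Nat.find_min hex hlt ⟨hk, hkm⟩
  have hanchor : ∀ e ∈ S.events, v <+: e.node → (S.anchor v (Nat.find hex)).isSome :=
    fun e he hv => hS.anchored e he v hv _ ⟨hl₁, hlj.trans_lt hj.2⟩ hlmax hmin
  generalize Nat.find hex = l at *
  -- Each miss time is matched with the location missed; no location is matched twice.
  refine Finset.card_le_card_of_forall_subsingleton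
    (fun τ x => ∃ p w, v <+: w ∧ S.Accesses τ p w x ∧ Execution.Misses H (S.content τ) j p x)
    ?_ ?_
  · intro τ hτ
    obtain ⟨p, w, x, hv, hA, hm⟩ := Execution.CacheRun.mem_missTimes.1 hτ
    exact ⟨x, hA.mem_footprint hv ht, p, w, hv, hA, hm⟩
  · rintro x - τ ⟨-, p, w, hv, hA, hm⟩ τ' ⟨-, p', w', hv', hA', hm'⟩
    obtain ⟨c, ha⟩ := Option.isSome_iff_exists.1 (hanchor _ (List.mem_of_getElem? hA.1) hv)
    rcases lt_trichotomy τ τ' with h | h | h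
    · exact absurd (hm'.mono hlj) (not_misses_of_lt hS ht ha hv hA (hm.mono hlj) hv' hA' h)
    · exact h
    · exact absurd (hm.mono hlj) (not_misses_of_lt hS ht ha hv' hA' (hm'.mono hlj) hv hA h)

/-- The hypothesis on the parent makes `Q` maximal as soon as it fits. It passes to the children
precisely when `Q` is a glue node, so the induction closes. -/
theorem card_missTimes_le_pcc (hσ : σ < 1) (hS : S.IsSpaceBounded σ) {j : ℕ}
    (hj : H.IsCacheLevel j) (t : SpawnTree Loc Typ) (Q : List ℕ) (hQ : P.tree.sub Q = some t)
    (hpar : ∀ u i, Q = u ++ [i] → ∀ s, P.tree.sub u = some s → σ * H.M j < (s.size : ℝ))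
    (hfit : t.StrandsFit (σ * H.M j)) :
    ((S.cacheRun hσ hS).missTimes Q j).card ≤ t.pcc (σ * H.M j) := by
  classical
  induction t generalizing Q with
  | strand first rest =>
    have hsize := hfit [] first rest rfl
    rw [SpawnTree.pcc, if_pos hsize]
    exact card_missTimes_le_size hσ hS hQ hj ⟨_, hQ, hsize, hpar⟩
  | node op ctl child ih =>
    by_cases hsize : ((SpawnTree.node op ctl child).size : ℝ) ≤ σ * H.M j
    · rw [SpawnTree.pcc, if_pos hsize]
      exact card_missTimes_le_size hσ hS hQ hj ⟨_, hQ, hsize, hpar⟩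
    · rw [SpawnTree.pcc, if_neg hsize]
      obtain ⟨s, hs, hsub⟩ := (S.cacheRun hσ hS).missTimes_subset_of_node j hQ
      refine (Finset.card_le_card hsub).trans ((Finset.card_union_le _ _).trans
        (add_le_add hs (Finset.card_biUnion_le.trans (Finset.sum_le_sum fun i _ => ?_))))
      have hi : ∀ p, (SpawnTree.node op ctl child).sub ((i : ℕ) :: p) = (child i).sub p :=
        fun p => by simp [SpawnTree.sub]
      refine ih i _ ?_ ?_ ?_
      · rw [SpawnTree.sub_append_of_eq_some hQ, hi, SpawnTree.sub_nil]
      · intro u k huk r hr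
        obtain ⟨rfl, -⟩ := List.append_inj' huk rfl
        rw [hQ] at hr
        cases hr
        exact not_le.1 hsize
      · intro w first rest hw
        exact hfit (i :: w) first rest ((hi w).trans hw)

end Schedule

end ND

theorem mainTheorem7 {Loc Typ : Type*} [DecidableEq Loc] (H : ND.PMH) (P : ND.Program Loc Typ)
    (σ : ℝ) (hσ0 : 0 < σ) (hσ1 : σ < 1) (S : ND.Schedule H P) (hS : S.IsSpaceBounded σ) :
    ∃ R : S.toExecution.CacheRun,
      ∀ (Q : List ℕ) (t : ND.SpawnTree Loc Typ) (i : ℕ),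
        P.tree.sub Q = some t → S.AnchoredAt Q i →
        ∀ j, H.IsCacheLevel j → j ≤ i → t.StrandsFit (σ * H.M j) →
          R.totalMisses Q j ≤ t.pcc (σ * H.M j) := by
  refine ⟨S.cacheRun hσ1 hS, fun Q t i hQ hanch j hj hji hfit => ?_⟩
  refine ((S.cacheRun hσ1 hS).totalMisses_le_card Q j).trans
    (ND.Schedule.card_missTimes_le_pcc hσ1 hS hj t Q hQ ?_ hfit)
  intro u k huk s hs
  rcases hanch with ⟨c, hc⟩ | ⟨-, rfl⟩
  · obtain ⟨hi, -, -, -, -, hpar⟩ := hS.anchor_maximal Q i c hc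
    -- The parent of `Q` exceeds `σ * M i`, hence also `σ * M j`, as capacities grow with the level.
    refine lt_of_le_of_lt ?_ (hpar u k huk s hs)
    exact mul_le_mul_of_nonneg_left (Nat.cast_le.2 (H.M_mono j i hj.1 hji hi.2)) hσ0.le
  · simp at huk
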